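/- A finite simple graph $G$ is representable in $\mathbb{R}^m$ if there are distinct positive constants $\alpha\ne\beta$ and a map $p$ from its vertex set to $\mathbb{R}^m$ such that, for all distinct vertices $u,v$, $\|p(u)-p(v)\|=\alpha$ if $u,v$ are adjacent and $\|p(u)-p(v)\|=\beta$ otherwise (Euclidean norm). The Euclidean representation number $\mathrm{Rep}(G)$ is the smallest $m\ge 0$ such that $G$ is representable in $\mathbb{R}^m$. Write $rK_t$ for the disjoint union of $r$ complete graphs on $t$ vertices each. Let $G$ be a regular graph on $n\ge 2$ vertices. Then $\mathrm{Rep}(G)$ exists, and the following hold. (a) If $G$ or its complement is isomorphic to $rK_{n/r}$ for some divisor $r$ of $n$ with $r\neq n$, then $$\mathrm{Rep}(G)=n-r .$$ (b) Otherwise (that is, if neither $G$ nor its complement is isomorphic to $rK_{n/r}$ for any divisor $r\ne n$ of $n$), let $\tau_1<\dots<\tau_s$ be the distinct eigenvalues of the adjacency matrix of $G$, and let $m_i$ be the multiplicity of $\tau_i$. If $G$ is connected, then $$\mathrm{Rep}(G)=n-1-\max\{m_1,m_{s-1}\}.$$ If $G$ is disconnected with $r$ connected components, then $$\mathrm{Rep}(G)=n-1-\max\{m_1,r-1\}.$$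 -/

import Mathlib

namespace SimpleGraph

/-- `G` is representable in `ℝ^m`: there are distinct positive constants `α`, `β` and a placement
of the vertices in Euclidean `m`-space such that adjacent vertices are at distance `α` and distinct
non-adjacent vertices are at distance `β` (so the placement is automatically injective). -/
def IsEuclideanRepresentable {V : Type*} (G : SimpleGraph V) (m : ℕ) : Prop :=
  ∃ (α β : ℝ) (p : V → EuclideanSpace ℝ (Fin m)), 0 < α ∧ 0 < β ∧ α ≠ β ∧
    (∀ u v, G.Adj u v → ‖p u - p v‖ = α) ∧
    (∀ u v, u ≠ v → ¬ G.Adj u v → ‖p u - p v‖ = β)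

/-- The Euclidean representation number: the least `m` such that `G` is representable in `ℝ^m`. -/
noncomputable def euclideanRepNumber {V : Type*} (G : SimpleGraph V) : ℕ :=
  sInf {m : ℕ | G.IsEuclideanRepresentable m}

/-- The graph `r K_t`, the disjoint union of `r` complete graphs on `t` vertices each. -/
def disjointCompleteGraphs (r t : ℕ) : SimpleGraph (Fin r × Fin t) where
  Adj x y := x.1 = y.1 ∧ x.2 ≠ y.2
  symm := ⟨fun _ _ h => ⟨h.1.symm, h.2.symm⟩⟩
  loopless := ⟨fun _ h => h.2 rfl⟩

/-- The set of (distinct) eigenvalues of the adjacency matrix. -/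
def adjEigenvalues {V : Type*} [Fintype V] [DecidableEq V] (G : SimpleGraph V)
    [DecidableRel G.Adj] : Set ℝ :=
  {θ | Module.End.HasEigenvalue (Matrix.toLin' (G.adjMatrix ℝ)) θ}

/-- The multiplicity of `θ` as an eigenvalue of the adjacency matrix, which is symmetric. -/
noncomputable def adjMultiplicity {V : Type*} [Fintype V] [DecidableEq V] (G : SimpleGraph V)
    [DecidableRel G.Adj] (θ : ℝ) : ℕ :=
  Module.finrank ℝ (Module.End.eigenspace (Matrix.toLin' (G.adjMatrix ℝ)) θ)

/-- The smallest eigenvalue. -/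
noncomputable def smallestEigenvalue {V : Type*} [Fintype V] [DecidableEq V] (G : SimpleGraph V)
    [DecidableRel G.Adj] : ℝ :=
  sInf G.adjEigenvalues

/-- The second largest distinct eigenvalue: the largest eigenvalue lying strictly below the
largest one. -/
noncomputable def secondLargestEigenvalue {V : Type*} [Fintype V] [DecidableEq V]
    (G : SimpleGraph V) [DecidableRel G.Adj] : ℝ :=
  sSup {θ ∈ G.adjEigenvalues | θ < sSup G.adjEigenvalues}

theorem adjEigenvalues_finite {V : Type*} [Fintype V] [DecidableEq V] (G : SimpleGraph V)
    [DecidableRel G.Adj] : G.adjEigenvalues.Finite :=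
  Module.End.finite_hasEigenvalue _

theorem adjEigenvalues_nonempty {V : Type*} [Fintype V] [DecidableEq V] [Nonempty V]
    (G : SimpleGraph V) [DecidableRel G.Adj] : G.adjEigenvalues.Nonempty := by
  have hA : (G.adjMatrix ℝ).IsHermitian := by
    rw [Matrix.IsHermitian, Matrix.conjTranspose_eq_transpose_of_trivial]
    exact G.transpose_adjMatrix
  obtain ⟨i⟩ := ‹Nonempty V›
  refine ⟨hA.eigenvalues i, Module.End.hasEigenvalue_of_hasEigenvector
    (x := (hA.eigenvectorBasis i).ofLp) ⟨?_, ?_⟩⟩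
  · rw [Module.End.mem_eigenspace_iff, Matrix.toLin'_apply]
    exact hA.mulVec_eigenvectorBasis i
  · intro h
    apply hA.eigenvectorBasis.toBasis.ne_zero i
    rw [OrthonormalBasis.coe_toBasis]
    ext j
    exact congrFun h j

/-- For a nonempty graph the smallest eigenvalue is what its name says. -/
theorem isLeast_smallestEigenvalue {V : Type*} [Fintype V] [DecidableEq V] [Nonempty V]
    (G : SimpleGraph V) [DecidableRel G.Adj] :
    IsLeast G.adjEigenvalues G.smallestEigenvalue :=
  ⟨G.adjEigenvalues_nonempty.csInf_mem G.adjEigenvalues_finite,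
    fun _ h => csInf_le G.adjEigenvalues_finite.bddBelow h⟩

/-- If there are two distinct eigenvalues, the second largest one is what its name says. -/
theorem isGreatest_secondLargestEigenvalue {V : Type*} [Fintype V] [DecidableEq V]
    (G : SimpleGraph V) [DecidableRel G.Adj] (h : G.adjEigenvalues.Nontrivial) :
    IsGreatest {θ ∈ G.adjEigenvalues | ∃ μ ∈ G.adjEigenvalues, θ < μ}
      G.secondLargestEigenvalue := by
  have hf := G.adjEigenvalues_finite
  have hmax := h.nonempty.csSup_mem hf
  have heq : {θ ∈ G.adjEigenvalues | ∃ μ ∈ G.adjEigenvalues, θ < μ} =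
      {θ ∈ G.adjEigenvalues | θ < sSup G.adjEigenvalues} := by
    ext θ
    constructor
    · rintro ⟨h1, μ, h2, h3⟩
      exact ⟨h1, h3.trans_le (le_csSup hf.bddAbove h2)⟩
    · rintro ⟨h1, h2⟩
      exact ⟨h1, _, hmax, h2⟩
  rw [heq]
  have hf' : {θ ∈ G.adjEigenvalues | θ < sSup G.adjEigenvalues}.Finite :=
    hf.subset (Set.sep_subset _ _)
  have hne : {θ ∈ G.adjEigenvalues | θ < sSup G.adjEigenvalues}.Nonempty := by
    obtain ⟨θ, h1, h2⟩ := h.exists_ne (sSup G.adjEigenvalues)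
    exact ⟨θ, h1, lt_of_le_of_ne (le_csSup hf.bddAbove h1) h2⟩
  exact ⟨hne.csSup_mem hf', fun _ hθ => le_csSup hf'.bddAbove hθ⟩

end SimpleGraph

/-! Let `a`, `b` be the squared distances for adjacent and non-adjacent pairs, and `A` the adjacency
matrix. On sum-zero vectors the Gram form of a representation is `(b + (b - a)A)/2`. Regularity
makes this space `A`-invariant, so `b + (b - a)μ ≥ 0` for every sum-zero eigenvalue `μ`, and the
form degenerates exactly on the eigenspace of `θ = b/(a - b)`. Such `θ` are the outer bounds, and
conversely each outer bound gives a representation (`IsOuterBound.exists_representable`). Hence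
`Rep(G) = n - 1 - M`, with `M` the largest sum-zero multiplicity of an outer bound
(`euclideanRepNumber_eq_of_isOuterBound`).

Only the least sum-zero eigenvalue, if below `-1`, and the greatest, if positive, can contribute.
Outside case (a) both do: an induced path on three vertices forces an eigenvalue below `-1`, and the
same in the complement forces a positive one. In `rK_t` the sum-zero eigenvalues lie in `{-1, t -
1}`, and `-1` is never an outer bound. -/

open Matrix Module

/-- A positive semidefinite real matrix is a Gram matrix in dimension equal to its rank. -/
theorem Matrix.PosSemidef.exists_inner_eq {V : Type*} [Fintype V] [DecidableEq V]
    {Q : Matrix V V ℝ} (hQ : Q.PosSemidef) :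
    ∃ p : V → EuclideanSpace ℝ (Fin Q.rank), ∀ u v, inner ℝ (p u) (p v) = Q u v := by
  have hH := hQ.isHermitian
  let e : Fin Q.rank ≃ {i // hH.eigenvalues i ≠ 0} :=
    (Fintype.equivFinOfCardEq hH.rank_eq_card_non_zero_eigs.symm).symm
  refine ⟨fun v => WithLp.toLp 2 fun i =>
    √(hH.eigenvalues (e i)) * hH.eigenvectorBasis (e i) v, fun u v => ?_⟩
  have h1 : Q u v = ∑ i, hH.eigenvalues i *
      (hH.eigenvectorBasis i u * hH.eigenvectorBasis i v) := by
    conv_lhs => rw [hH.spectral_theorem]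
    simp [Unitary.conjStarAlgAut_apply, Matrix.mul_apply, Matrix.diagonal_apply,
      IsHermitian.eigenvectorUnitary_apply]
    exact Finset.sum_congr rfl fun i _ => by ring
  have h2 : ∀ i, √(hH.eigenvalues i) * √(hH.eigenvalues i) = hH.eigenvalues i := fun i =>
    Real.mul_self_sqrt (hQ.eigenvalues_nonneg i)
  have h3 : ∀ i, i ∉ Set.range (fun j => (e j : V)) → hH.eigenvalues i *
      (hH.eigenvectorBasis i u * hH.eigenvectorBasis i v) = 0 := by
    intro i hi
    by_contra h
    exact hi ⟨e.symm ⟨i, left_ne_zero_of_mul h⟩, by simp⟩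
  have h4 : Function.Injective fun j => (e j : V) := Subtype.val_injective.comp e.injective
  rw [h1, ← Fintype.sum_of_injective _ h4 _ _ h3 fun _ => rfl, PiLp.inner_apply]
  refine Finset.sum_congr rfl fun i _ => ?_
  conv_rhs => rw [← h2]
  simp only [RCLike.inner_apply, conj_trivial]
  ring

namespace SimpleGraph

/-! ### Sum-zero vectors. -/

section SumZero

variable {V : Type*} [Fintype V]

/-- The vectors whose coordinates sum to zero. -/
def sumZero (V : Type*) [Fintype V] : Submodule ℝ (V → ℝ) :=
  LinearMap.ker (∑ v, LinearMap.proj v : (V → ℝ) →ₗ[ℝ] ℝ)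

theorem mem_sumZero {x : V → ℝ} : x ∈ sumZero V ↔ ∑ v, x v = 0 := by
  simp [sumZero, LinearMap.sum_apply]

/-- The coordinate sum does not vanish at `1 ∈ K`, so its kernel has codimension one in `K`. -/
theorem finrank_inf_sumZero [Nonempty V] (K : Submodule ℝ (V → ℝ)) (h : (1 : V → ℝ) ∈ K) :
    finrank ℝ (K ⊓ sumZero V : Submodule ℝ (V → ℝ)) + 1 = finrank ℝ K := by
  let f : (V → ℝ) →ₗ[ℝ] ℝ := ∑ v, LinearMap.proj v
  have h1 := (f.domRestrict K).finrank_range_add_finrank_ker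
  have h2 : LinearMap.range (f.domRestrict K) = ⊤ := by
    apply LinearMap.range_eq_top.2
    apply LinearMap.surjective
    intro h0
    have := congrArg (fun g => g ⟨1, h⟩) h0
    simp [f, LinearMap.sum_apply] at this
  have h3 : (LinearMap.ker (f.domRestrict K)).map K.subtype = K ⊓ sumZero V := by
    rw [LinearMap.ker_domRestrict, Submodule.map_comap_subtype]
    rfl
  rw [← h3, Submodule.finrank_map_subtype_eq]
  rw [h2, finrank_top, finrank_self] at h1
  omega

end SumZero

/-! ### Representations and outer bounds. -/

section Multiplicity

variable {V : Type*} [Fintype V] [DecidableEq V] (G : SimpleGraph V) [DecidableRel G.Adj]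

/-- The multiplicity of `θ` as an eigenvalue of the adjacency matrix on the sum-zero vectors. -/
noncomputable def sumZeroMultiplicity (θ : ℝ) : ℕ :=
  finrank ℝ (End.eigenspace (toLin' (G.adjMatrix ℝ)) θ ⊓ sumZero V : Submodule ℝ (V → ℝ))

/-- `θ` is an eigenvalue of the adjacency matrix with a sum-zero eigenvector. -/
def IsSumZeroEigenvalue (θ : ℝ) : Prop :=
  ∃ x : V → ℝ, x ≠ 0 ∧ ∑ v, x v = 0 ∧ G.adjMatrix ℝ *ᵥ x = θ • x

/-- `θ` lies outside `[-1, 0]` and is an outer bound, on its side, for the eigenvalues with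
sum-zero eigenvectors. -/
def IsOuterBound (θ : ℝ) : Prop :=
  (θ < -1 ∧ ∀ μ, G.IsSumZeroEigenvalue μ → θ ≤ μ) ∨
    (0 < θ ∧ ∀ μ, G.IsSumZeroEigenvalue μ → μ ≤ θ)

variable {G}

theorem sumZeroMultiplicity_pos_iff {θ : ℝ} :
    0 < G.sumZeroMultiplicity θ ↔ G.IsSumZeroEigenvalue θ := by
  rw [sumZeroMultiplicity, finrank_pos_iff, Submodule.nontrivial_iff_ne_bot, Submodule.ne_bot_iff]
  refine exists_congr fun x => ?_
  rw [Submodule.mem_inf, mem_sumZero, End.mem_eigenspace_iff, toLin'_apply]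
  tauto

variable {k : ℕ} (hG : G.IsRegularOfDegree k)
include hG

omit [DecidableEq V] in
theorem adjMatrix_mulVec_one : G.adjMatrix ℝ *ᵥ 1 = (k : ℝ) • (1 : V → ℝ) := by
  ext v
  have := adjMatrix_mulVec_const_apply_of_regular (α := ℝ) (a := 1) hG (v := v)
  rwa [mul_one, ← mul_one (k : ℝ)] at this

omit [DecidableEq V] in
theorem sum_adjMatrix_mulVec (x : V → ℝ) :
    ∑ v, (G.adjMatrix ℝ *ᵥ x) v = k * ∑ v, x v := by
  rw [← one_dotProduct, dotProduct_mulVec, ← mulVec_transpose, transpose_adjMatrix,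
    adjMatrix_mulVec_one hG, smul_dotProduct, one_dotProduct, smul_eq_mul]

theorem IsEuclideanRepresentable.exists_isOuterBound {m : ℕ} (h : G.IsEuclideanRepresentable m) :
    ∃ θ, G.IsOuterBound θ ∧ Fintype.card V ≤ m + 1 + G.sumZeroMultiplicity θ := by
  obtain ⟨α, β, p, hα, hβ, hne, hadj, hnadj⟩ := h
  set a := α ^ 2
  set b := β ^ 2
  have ha0 : 0 < a := by positivity
  have hb0 : 0 < b := by positivity
  have hab : a - b ≠ 0 := by
    rw [sub_ne_zero]
    exact fun h => hne ((sq_eq_sq₀ hα.le hβ.le).1 h)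
  let T : (V → ℝ) →ₗ[ℝ] EuclideanSpace ℝ (Fin m) := Fintype.linearCombination ℝ p
  have hT : ∀ x, T x = ∑ v, x v • p v := fun x => by
    simp [T, Fintype.linearCombination_apply]
  have hp : ∀ u v, inner ℝ (p u) (p v) = (‖p u‖ ^ 2 + ‖p v‖ ^ 2 - b
      + b * (1 : Matrix V V ℝ) u v + (b - a) * G.adjMatrix ℝ u v) / 2 := by
    intro u v
    have h1 := norm_sub_sq_real (p u) (p v)
    rcases eq_or_ne u v with rfl | huv
    · simp
    · by_cases h : G.Adj u v
      · rw [hadj u v h] at h1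
        simp [h, huv]
        linarith
      · rw [hnadj u v huv h] at h1
        simp [h, huv]
        linarith
  have hinner : ∀ x y : V → ℝ, ∑ v, x v = 0 → ∑ v, y v = 0 →
      inner ℝ (T x) (T y) = (b * (x ⬝ᵥ y) + (b - a) * (x ⬝ᵥ G.adjMatrix ℝ *ᵥ y)) / 2 := by
    intro x y hx hy
    have e1 : x ⬝ᵥ y = ∑ u, ∑ v, x u * y v * (1 : Matrix V V ℝ) u v := by
      simp [Matrix.one_apply, dotProduct]
    have e2 : x ⬝ᵥ G.adjMatrix ℝ *ᵥ y = ∑ u, ∑ v, x u * y v * G.adjMatrix ℝ u v := by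
      simp only [dotProduct, mulVec, Finset.mul_sum]
      exact Finset.sum_congr rfl fun u _ => Finset.sum_congr rfl fun v _ => by ring
    have e3 : ∑ u, ∑ v, x u * y v * ‖p u‖ ^ 2 = 0 := by
      refine Finset.sum_eq_zero fun u _ => ?_
      rw [← Finset.sum_mul, ← Finset.mul_sum, hy]
      ring
    have e4 : ∑ u, ∑ v, x u * y v * ‖p v‖ ^ 2 = 0 := by
      rw [Finset.sum_comm]
      refine Finset.sum_eq_zero fun u _ => ?_
      rw [← Finset.sum_mul, ← Finset.sum_mul, hx]
      ring
    have e6 : inner ℝ (T x) (T y) = ∑ u, ∑ v, ((x u * y v * ‖p u‖ ^ 2) / 2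
        + (x u * y v * ‖p v‖ ^ 2) / 2 - b / 2 * (x u * y v)
        + b / 2 * (x u * y v * (1 : Matrix V V ℝ) u v)
        + (b - a) / 2 * (x u * y v * G.adjMatrix ℝ u v)) := by
      rw [hT, hT, sum_inner]
      refine Finset.sum_congr rfl fun u _ => ?_
      rw [inner_sum]
      refine Finset.sum_congr rfl fun v _ => ?_
      rw [real_inner_smul_left, real_inner_smul_right, hp]
      ring
    simp only [Finset.sum_add_distrib, Finset.sum_sub_distrib, ← Finset.mul_sum,
      ← Finset.sum_div] at e6
    rw [e6, e3, e4, ← e1, ← e2]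
    simp only [hy, mul_zero, Finset.sum_const_zero]
    ring
  -- The root of `b + (b - a)θ`: below `-1` if `a < b`, positive if `a > b`.
  refine ⟨b / (a - b), ?_, ?_⟩
  · have key : ∀ μ, G.IsSumZeroEigenvalue μ → 0 ≤ b + (b - a) * μ := by
      rintro μ ⟨x, hx0, hx, hμ⟩
      have h1 := hinner x x hx hx
      rw [hμ, dotProduct_smul, smul_eq_mul] at h1
      have h2 : 0 ≤ inner ℝ (T x) (T x) := real_inner_self_nonneg
      have h3 : 0 < x ⬝ᵥ x := by
        have := dotProduct_star_self_pos_iff.2 hx0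
        simpa using this
      rw [h1] at h2
      by_contra hneg
      have := mul_neg_of_neg_of_pos (not_le.1 hneg) h3
      linarith
    rcases lt_or_gt_of_ne hab with h | h
    · left
      refine ⟨?_, fun μ hμ => ?_⟩
      · rw [div_lt_iff_of_neg h]
        linarith
      · rw [div_le_iff_of_neg h]
        linarith [key μ hμ]
    · right
      refine ⟨by positivity, fun μ hμ => ?_⟩
      rw [le_div_iff₀ h]
      linarith [key μ hμ]
  · let S : (V → ℝ) →ₗ[ℝ] EuclideanSpace ℝ (Fin m) × ℝ := T.prod (∑ v, LinearMap.proj v)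
    have hr := S.finrank_range_add_finrank_ker
    have hr1 : finrank ℝ (LinearMap.range S) ≤ m + 1 := by
      simpa using Submodule.finrank_le (LinearMap.range S)
    rw [finrank_fintype_fun_eq_card] at hr
    have hker : LinearMap.ker S ≤
        End.eigenspace (toLin' (G.adjMatrix ℝ)) (b / (a - b)) ⊓ sumZero V := by
      intro x hx
      have hx' : T x = 0 ∧ ∑ v, x v = 0 := by
        simpa [S, LinearMap.sum_apply] using hx
      obtain ⟨hx1, hx2⟩ := hx'
      refine Submodule.mem_inf.2 ⟨?_, mem_sumZero.2 hx2⟩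
      rw [End.mem_eigenspace_iff, toLin'_apply]
      -- By regularity `y` has sum zero, so it can be paired with `x`: `y ⬝ᵥ y = 2⟪T y, T x⟫ = 0`.
      set y : V → ℝ := b • x + (b - a) • (G.adjMatrix ℝ *ᵥ x) with hy
      have hy0 : ∑ v, y v = 0 := by
        simp only [hy, Pi.add_apply, Pi.smul_apply, smul_eq_mul, Finset.sum_add_distrib,
          ← Finset.mul_sum, sum_adjMatrix_mulVec hG, hx2]
        ring
      have h1 := hinner y x hy0 hx2
      rw [hx1, inner_zero_right] at h1
      have h2 : y ⬝ᵥ y = 0 := by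
        conv_lhs => rw [hy, dotProduct_add, dotProduct_smul, dotProduct_smul]
        simp only [smul_eq_mul]
        linarith
      have h3 : y = 0 := dotProduct_self_eq_zero.1 h2
      ext v
      have h4 := congrFun h3 v
      simp only [hy, Pi.add_apply, Pi.smul_apply, smul_eq_mul, Pi.zero_apply] at h4 ⊢
      field_simp
      linarith
    have := Submodule.finrank_mono hker
    rw [sumZeroMultiplicity]
    omega

theorem IsOuterBound.exists_representable [Nonempty V] {θ : ℝ} (h : G.IsOuterBound θ) :
    ∃ m, G.IsEuclideanRepresentable m ∧ m + 1 + G.sumZeroMultiplicity θ ≤ Fintype.card V := by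
  obtain ⟨a, b, ha, hb, hab, hθ, hpos⟩ : ∃ a b : ℝ, 0 < a ∧ 0 < b ∧ a ≠ b ∧
      b + (b - a) * θ = 0 ∧ ∀ μ, G.IsSumZeroEigenvalue μ → 0 ≤ b + (b - a) * μ := by
    rcases h with ⟨h1, h2⟩ | ⟨h1, h2⟩
    -- Solutions of `b/(a - b) = θ` scaled so that `|b - a| = 1`.
    · exact ⟨-θ - 1, -θ, by linarith, by linarith, by linarith, by ring,
        fun μ hμ => by linarith [h2 μ hμ]⟩
    · exact ⟨θ + 1, θ, by linarith, by linarith, by linarith, by ring,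
        fun μ hμ => by linarith [h2 μ hμ]⟩
  have hba : b - a ≠ 0 := sub_ne_zero.2 hab.symm
  have hn : (Fintype.card V : ℝ) ≠ 0 := by simp
  -- Chosen so that `Q` kills `1`; the constant term does not affect distances.
  set c : ℝ := -(b + (b - a) * k) / Fintype.card V with hc
  let Q : Matrix V V ℝ := b • 1 + (b - a) • G.adjMatrix ℝ + c • of 1
  have hQx : ∀ x : V → ℝ, Q *ᵥ x =
      b • x + (b - a) • (G.adjMatrix ℝ *ᵥ x) + (c * ∑ v, x v) • 1 := by
    intro x
    have : (of 1 : Matrix V V ℝ) *ᵥ x = (∑ v, x v) • 1 := by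
      ext v
      simp [mulVec, dotProduct]
    simp only [Q, add_mulVec, smul_mulVec, one_mulVec, this, smul_smul]
  have hQ1 : Q *ᵥ 1 = 0 := by
    rw [hQx, adjMatrix_mulVec_one hG]
    ext v
    simp [hc]
  have hQH : Q.IsHermitian := by
    ext u v
    simp [Q, Matrix.one_apply, adj_comm, eq_comm]
  have hQt : Qᵀ = Q := by simpa using hQH.eq
  have hQP : Q.PosSemidef := by
    rw [hQH.posSemidef_iff_eigenvalues_nonneg]
    intro i
    set lam := hQH.eigenvalues i
    set x : V → ℝ := (hQH.eigenvectorBasis i).ofLp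
    have hQi : Q *ᵥ x = lam • x := hQH.mulVec_eigenvectorBasis i
    have hx0 : x ≠ 0 := by
      intro h
      apply hQH.eigenvectorBasis.toBasis.ne_zero i
      rw [OrthonormalBasis.coe_toBasis]
      ext j
      exact congrFun h j
    show 0 ≤ lam
    by_cases h0 : lam = 0
    · rw [h0]
    -- An eigenvector with nonzero eigenvalue is orthogonal to `1`, which lies in the kernel.
    have hs : ∑ v, x v = 0 := by
      have h1 : (1 : V → ℝ) ⬝ᵥ Q *ᵥ x = 0 := by
        rw [dotProduct_mulVec, ← mulVec_transpose, hQt, hQ1, zero_dotProduct]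
      rw [hQi, dotProduct_smul, one_dotProduct, smul_eq_mul] at h1
      exact (mul_eq_zero.1 h1).resolve_left h0
    have h2 := hpos ((lam - b) / (b - a)) ⟨x, hx0, hs, ?_⟩
    · rw [mul_div_cancel₀ _ hba] at h2
      linarith
    · rw [hQx, hs] at hQi
      ext v
      have := congrFun hQi v
      simp only [Pi.add_apply, Pi.smul_apply, smul_eq_mul, mul_zero, zero_mul] at this ⊢
      field_simp
      linarith
  obtain ⟨p, hp⟩ := hQP.exists_inner_eq
  have hdist : ∀ u v, ‖p u - p v‖ ^ 2 = Q u u - 2 * Q u v + Q v v := by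
    intro u v
    rw [norm_sub_sq_real, hp, ← real_inner_self_eq_norm_sq, ← real_inner_self_eq_norm_sq, hp, hp]
  refine ⟨Q.rank, ⟨√(2 * a), √(2 * b), p, by positivity, by positivity, ?_, ?_, ?_⟩, ?_⟩
  · intro h
    rw [Real.sqrt_inj (by positivity) (by positivity)] at h
    exact hab (by linarith)
  · intro u v h
    rw [eq_comm, Real.sqrt_eq_iff_eq_sq (by positivity) (by positivity), hdist]
    simp [Q, h, h.ne]
    ring
  · intro u v huv h
    rw [eq_comm, Real.sqrt_eq_iff_eq_sq (by positivity) (by positivity), hdist]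
    simp [Q, h, huv]
    ring
  · have h1 := (toLin' Q).finrank_range_add_finrank_ker
    rw [finrank_fintype_fun_eq_card] at h1
    -- Besides the `θ`-eigenvectors, the kernel contains `1`: this lowers the rank by one more.
    have h2 := finrank_inf_sumZero (LinearMap.ker (toLin' Q)) (by simpa using hQ1)
    have h3 : End.eigenspace (toLin' (G.adjMatrix ℝ)) θ ⊓ sumZero V ≤
        LinearMap.ker (toLin' Q) ⊓ sumZero V := by
      refine le_inf (fun x hx => ?_) inf_le_right
      obtain ⟨hx1, hx2⟩ := Submodule.mem_inf.1 hx
      rw [End.mem_eigenspace_iff, toLin'_apply] at hx1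
      rw [mem_sumZero] at hx2
      rw [LinearMap.mem_ker, toLin'_apply, hQx, hx1, hx2, mul_zero, zero_smul, add_zero, smul_smul,
        ← add_smul, hθ, zero_smul]
    have h4 := Submodule.finrank_mono h3
    have h5 : finrank ℝ (LinearMap.range (toLin' Q)) = Q.rank := rfl
    rw [sumZeroMultiplicity]
    omega

theorem euclideanRepNumber_eq_of_isOuterBound [Nonempty V] {M : ℕ}
    (hle : ∀ θ, G.IsOuterBound θ → G.sumZeroMultiplicity θ ≤ M)
    (hex : ∃ θ, G.IsOuterBound θ ∧ M ≤ G.sumZeroMultiplicity θ) :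
    G.euclideanRepNumber + 1 + M = Fintype.card V := by
  obtain ⟨θ, h1, h2⟩ := hex
  obtain ⟨m, h3, h4⟩ := h1.exists_representable hG
  -- `sInf ∅ = 0` in `ℕ`, so attainment needs a representation at hand.
  have h5 : G.IsEuclideanRepresentable G.euclideanRepNumber := 
    Nat.sInf_mem (s := {m | G.IsEuclideanRepresentable m}) ⟨m, h3⟩
  have h6 : G.euclideanRepNumber ≤ m := Nat.sInf_le h3
  obtain ⟨θ', h7, h8⟩ := h5.exists_isOuterBound hG
  have := hle θ' h7
  omega

end Multiplicity

/-! ### Invariance under complement and isomorphism. -/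

section Representability

variable {V W : Type*} {G : SimpleGraph V} {H : SimpleGraph W} {m : ℕ}

theorem IsEuclideanRepresentable.compl (h : G.IsEuclideanRepresentable m) :
    Gᶜ.IsEuclideanRepresentable m := by
  obtain ⟨α, β, p, hα, hβ, hne, h1, h2⟩ := h
  refine ⟨β, α, p, hβ, hα, hne.symm, fun u v h => ?_, fun u v huv h => ?_⟩
  · rw [compl_adj] at h
    exact h2 u v h.1 h.2
  · rw [compl_adj, not_and, not_not] at h
    exact h1 u v (h huv)

theorem euclideanRepNumber_compl : Gᶜ.euclideanRepNumber = G.euclideanRepNumber := by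
  unfold euclideanRepNumber
  congr 1
  ext m
  exact ⟨fun h => by simpa using IsEuclideanRepresentable.compl h, fun h => h.compl⟩

theorem IsEuclideanRepresentable.of_iso (e : G ≃g H) (h : H.IsEuclideanRepresentable m) :
    G.IsEuclideanRepresentable m := by
  obtain ⟨α, β, p, hα, hβ, hne, h1, h2⟩ := h
  exact ⟨α, β, p ∘ e, hα, hβ, hne, fun u v h => h1 _ _ (e.map_adj_iff.2 h),
    fun u v huv h => h2 _ _ (e.injective.ne huv) (mt e.map_adj_iff.1 h)⟩

theorem euclideanRepNumber_congr (e : G ≃g H) : G.euclideanRepNumber = H.euclideanRepNumber := by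
  unfold euclideanRepNumber
  congr 1
  ext m
  exact ⟨.of_iso e.symm, .of_iso e⟩

end Representability

/-! ### Spectrum of a regular graph. -/

section Spectrum

variable {V : Type*} [Fintype V] [DecidableEq V] {G : SimpleGraph V} [DecidableRel G.Adj]

theorem mem_adjEigenvalues_iff {θ : ℝ} :
    θ ∈ G.adjEigenvalues ↔ ∃ x : V → ℝ, x ≠ 0 ∧ G.adjMatrix ℝ *ᵥ x = θ • x := by
  refine ⟨fun h => ?_, fun ⟨x, hx, h⟩ => End.hasEigenvalue_of_hasEigenvector (x := x) ⟨?_, hx⟩⟩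
  · obtain ⟨x, hx, hx0⟩ := End.HasEigenvalue.exists_hasEigenvector h
    rw [End.mem_eigenspace_iff, toLin'_apply] at hx
    exact ⟨x, hx0, hx⟩
  · rwa [End.mem_eigenspace_iff, toLin'_apply]

theorem IsSumZeroEigenvalue.mem_adjEigenvalues {θ : ℝ} (h : G.IsSumZeroEigenvalue θ) :
    θ ∈ G.adjEigenvalues := by
  obtain ⟨x, hx, -, h⟩ := h
  exact mem_adjEigenvalues_iff.2 ⟨x, hx, h⟩

variable {k : ℕ} (hG : G.IsRegularOfDegree k)
include hG

omit [DecidableEq V] in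
theorem sum_eq_zero_of_mulVec_eq {θ : ℝ} {x : V → ℝ} (h : G.adjMatrix ℝ *ᵥ x = θ • x)
    (hθ : θ ≠ k) : ∑ v, x v = 0 := by
  have h1 := sum_adjMatrix_mulVec hG x
  simp only [h, Pi.smul_apply, smul_eq_mul, ← Finset.mul_sum] at h1
  by_contra h0
  exact hθ (mul_right_cancel₀ h0 h1)

theorem isSumZeroEigenvalue_of_ne {θ : ℝ} (h : θ ∈ G.adjEigenvalues) (hθ : θ ≠ k) :
    G.IsSumZeroEigenvalue θ := by
  obtain ⟨x, hx, h⟩ := mem_adjEigenvalues_iff.1 h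
  exact ⟨x, hx, sum_eq_zero_of_mulVec_eq hG h hθ, h⟩

theorem adjMultiplicity_eq_of_ne {θ : ℝ} (hθ : θ ≠ k) :
    G.adjMultiplicity θ = G.sumZeroMultiplicity θ := by
  rw [adjMultiplicity, sumZeroMultiplicity, inf_eq_left.2]
  intro x hx
  rw [End.mem_eigenspace_iff, toLin'_apply] at hx
  exact mem_sumZero.2 (sum_eq_zero_of_mulVec_eq hG hx hθ)

theorem lapMatrix_mulVec_of_isRegularOfDegree (x : V → ℝ) :
    G.lapMatrix ℝ *ᵥ x = (k : ℝ) • x - G.adjMatrix ℝ *ᵥ x := by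
  ext v
  rw [lapMatrix_mulVec_apply, hG.degree_eq]
  simp [adjMatrix_mulVec_apply]

theorem le_of_mem_adjEigenvalues {θ : ℝ} (h : θ ∈ G.adjEigenvalues) : θ ≤ k := by
  obtain ⟨x, hx, h⟩ := mem_adjEigenvalues_iff.1 h
  have h1 := (G.posSemidef_lapMatrix ℝ).dotProduct_mulVec_nonneg x
  rw [lapMatrix_mulVec_of_isRegularOfDegree hG, h, ← sub_smul, dotProduct_smul, smul_eq_mul] at h1
  have h2 : 0 < star x ⬝ᵥ x := dotProduct_star_self_pos_iff.2 hx
  linarith [nonneg_of_mul_nonneg_left h1 h2]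

theorem natCast_mem_adjEigenvalues [Nonempty V] : (k : ℝ) ∈ G.adjEigenvalues :=
  mem_adjEigenvalues_iff.2 ⟨1, one_ne_zero, adjMatrix_mulVec_one hG⟩

/-- The `k`-eigenspace is the kernel of the Laplacian `k - A`; restricting to sum zero removes the
direction `1`. -/
theorem sumZeroMultiplicity_natCast_add_one [Nonempty V] :
    G.sumZeroMultiplicity k + 1 = Nat.card G.ConnectedComponent := by
  classical
  rw [Nat.card_eq_fintype_card, card_connectedComponent_eq_finrank_ker_toLin'_lapMatrix,
    sumZeroMultiplicity, finrank_inf_sumZero]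
  · suffices h : End.eigenspace (toLin' (G.adjMatrix ℝ)) k = (G.lapMatrix ℝ).toLin'.ker by
      rw [h]
    ext x
    rw [End.mem_eigenspace_iff, LinearMap.mem_ker, toLin'_apply, toLin'_apply,
      lapMatrix_mulVec_of_isRegularOfDegree hG, sub_eq_zero, eq_comm]
  · rw [End.mem_eigenspace_iff, toLin'_apply, adjMatrix_mulVec_one hG]

theorem isEuclideanRepresentable_euclideanRepNumber [Nonempty V] :
    G.IsEuclideanRepresentable G.euclideanRepNumber := by
  have h : G.IsOuterBound (k + 1) := Or.inr ⟨by positivity, fun μ hμ => by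
    linarith [le_of_mem_adjEigenvalues hG hμ.mem_adjEigenvalues]⟩
  obtain ⟨m, hm, -⟩ := h.exists_representable hG
  exact Nat.sInf_mem (s := {m | G.IsEuclideanRepresentable m}) ⟨m, hm⟩

/-- Otherwise `1 + A` would be positive semidefinite, which the induced path `u, v, w` refutes. -/
theorem exists_isSumZeroEigenvalue_lt_neg_one_of_not_adj {u v w : V} (huv : G.Adj u v)
    (hvw : G.Adj v w) (hne : u ≠ w) (huw : ¬ G.Adj u w) :
    ∃ μ, G.IsSumZeroEigenvalue μ ∧ μ < -1 := by
  by_contra! hge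
  have hH : (1 + G.adjMatrix ℝ).IsHermitian := isHermitian_one.add (G.isHermitian_adjMatrix ℝ)
  have hP : (1 + G.adjMatrix ℝ).PosSemidef := by
    rw [hH.posSemidef_iff_eigenvalues_nonneg]
    intro i
    set lam := hH.eigenvalues i
    set x : V → ℝ := (hH.eigenvectorBasis i).ofLp
    have hi : (1 + G.adjMatrix ℝ) *ᵥ x = lam • x := hH.mulVec_eigenvectorBasis i
    have hx0 : x ≠ 0 := by
      intro h
      apply hH.eigenvectorBasis.toBasis.ne_zero i
      rw [OrthonormalBasis.coe_toBasis]
      ext j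
      exact congrFun h j
    show 0 ≤ lam
    have h1 : G.adjMatrix ℝ *ᵥ x = (lam - 1) • x := by
      rw [sub_smul, one_smul, ← hi, add_mulVec, one_mulVec, add_sub_cancel_left]
    by_cases h2 : lam - 1 = k
    · have : (0 : ℝ) ≤ k := k.cast_nonneg
      linarith
    · linarith [hge _ ⟨x, hx0, sum_eq_zero_of_mulVec_eq hG h1 h2, h1⟩]
  -- The form takes the value `3 - 4 = -1` here.
  have h := hP.dotProduct_mulVec_nonneg (Pi.single u 1 - Pi.single v 1 + Pi.single w 1)
  have h1 : ¬ G.Adj w u := fun h => huw h.symm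
  simp [star_trivial, mulVec_add, mulVec_sub, add_dotProduct, sub_dotProduct,
    dotProduct_add, dotProduct_sub, huv, huv.symm, hvw, hvw.symm, huw, h1, huv.ne, huv.ne',
    hvw.ne, hvw.ne', hne, hne.symm] at h
  norm_num at h

/-- "Equal or adjacent" is an equivalence relation, and regularity gives every class `k + 1`
elements. -/
theorem exists_iso_disjointCompleteGraphs
    (htrans : ∀ u v w, G.Adj u v → G.Adj v w → u ≠ w → G.Adj u w) :
    ∃ r, Nonempty (G ≃g disjointCompleteGraphs r (k + 1)) := by
  classical
  let s : Setoid V :=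
    { r := fun u v => u = v ∨ G.Adj u v
      iseqv := ⟨fun _ => Or.inl rfl, fun h => h.imp Eq.symm Adj.symm, fun {u v w} h h' => by
        rcases h with rfl | h
        · exact h'
        · rcases h' with rfl | h'
          · exact Or.inr h
          · exact or_iff_not_imp_left.2 (htrans u v w h h')⟩ }
  have hs : ∀ u v : V, (Quotient.mk s u = Quotient.mk s v) ↔ (u = v ∨ G.Adj u v) :=
    fun u v => Quotient.eq
  have hcard : ∀ q : Quotient s, Fintype.card {v // Quotient.mk s v = q} = k + 1 := by
    intro q
    obtain ⟨u, rfl⟩ := Quotient.exists_rep q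
    rw [Fintype.card_of_subtype (insert u (G.neighborFinset u)),
      Finset.card_insert_of_notMem (by simp), card_neighborFinset_eq_degree, hG.degree_eq]
    intro v
    rw [hs, Finset.mem_insert, mem_neighborFinset, adj_comm]
  let e : V ≃ Fin (Fintype.card (Quotient s)) × Fin (k + 1) :=
    (Equiv.sigmaFiberEquiv (Quotient.mk s)).symm.trans <|
      (Equiv.sigmaCongrRight fun q => Fintype.equivFinOfCardEq (hcard q)).trans <|
        (Equiv.sigmaEquivProd _ _).trans <| (Fintype.equivFin _).prodCongr (Equiv.refl _)
  have he : ∀ v, (e v).1 = Fintype.equivFin _ (Quotient.mk s v) := fun v => rfl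
  refine ⟨_, ⟨⟨e, fun {u v} => ?_⟩⟩⟩
  have h1 : (e u).1 = (e v).1 ↔ (u = v ∨ G.Adj u v) := by
    rw [he, he, EmbeddingLike.apply_eq_iff_eq, hs]
  have h2 : u = v ↔ (e u).1 = (e v).1 ∧ (e u).2 = (e v).2 := by
    rw [← Prod.ext_iff, EmbeddingLike.apply_eq_iff_eq]
  show (e u).1 = (e v).1 ∧ (e u).2 ≠ (e v).2 ↔ G.Adj u v
  have h3 : G.Adj u v → u ≠ v := Adj.ne
  tauto

theorem exists_isSumZeroEigenvalue_lt_neg_one [Nonempty V] (hk : 0 < k)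
    (h : ¬ ∃ r t : ℕ, r ≠ Fintype.card V ∧ Nonempty (G ≃g disjointCompleteGraphs r t)) :
    ∃ μ, G.IsSumZeroEigenvalue μ ∧ μ < -1 := by
  by_contra hlt
  have htrans : ∀ u v w, G.Adj u v → G.Adj v w → u ≠ w → G.Adj u w := by
    intro u v w huv hvw hne
    by_contra huw
    exact hlt (exists_isSumZeroEigenvalue_lt_neg_one_of_not_adj hG huv hvw hne huw)
  obtain ⟨r, ⟨e⟩⟩ := exists_iso_disjointCompleteGraphs hG htrans
  refine h ⟨r, k + 1, fun hr => ?_, ⟨e⟩⟩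
  have h1 := Fintype.card_congr e.toEquiv
  rw [Fintype.card_prod, Fintype.card_fin, Fintype.card_fin, ← hr] at h1
  have h2 : 0 < r := hr ▸ Fintype.card_pos
  nlinarith

omit hG in
-- The two adjacency matrices and the identity add up to the all-ones matrix, which kills sum-zero
-- vectors.
theorem IsSumZeroEigenvalue.of_compl {μ : ℝ} (h : Gᶜ.IsSumZeroEigenvalue μ) :
    G.IsSumZeroEigenvalue (-1 - μ) := by
  obtain ⟨x, hx0, hx, h⟩ := h
  refine ⟨x, hx0, hx, ?_⟩
  have h1 := congrArg (fun M => M *ᵥ x)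
    (one_add_adjMatrix_add_compl_adjMatrix_eq_of_one (G := G) (α := ℝ))
  have h2 : (of 1 : Matrix V V ℝ) *ᵥ x = 0 := by
    ext v
    simp [mulVec, dotProduct, hx]
  simp only [compl_adjMatrix_eq_adjMatrix_compl, add_mulVec, one_mulVec, h, h2] at h1
  rw [sub_smul, neg_smul, one_smul, eq_sub_iff_add_eq, eq_neg_iff_add_eq_zero, ← h1]
  abel

end Spectrum

/-! ### The graphs `rK_t`. -/

section DisjointCompleteGraphs

variable {r t : ℕ}

instance : DecidableRel (disjointCompleteGraphs r t).Adj := fun x y =>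
  inferInstanceAs (Decidable (x.1 = y.1 ∧ x.2 ≠ y.2))

theorem neighborFinset_disjointCompleteGraphs (x : Fin r × Fin t) :
    (disjointCompleteGraphs r t).neighborFinset x = {x.1} ×ˢ Finset.univ.erase x.2 := by
  ext y
  rw [mem_neighborFinset, Finset.mem_product, Finset.mem_singleton, Finset.mem_erase]
  simp [disjointCompleteGraphs, eq_comm]

theorem isRegularOfDegree_disjointCompleteGraphs :
    (disjointCompleteGraphs r t).IsRegularOfDegree (t - 1) := by
  intro x
  rw [← card_neighborFinset_eq_degree, neighborFinset_disjointCompleteGraphs]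
  simp

theorem natCard_connectedComponent_disjointCompleteGraphs (ht : 0 < t) :
    Nat.card (disjointCompleteGraphs r t).ConnectedComponent = r := by
  let f : (disjointCompleteGraphs r t).ConnectedComponent → Fin r :=
    ConnectedComponent.lift Prod.fst fun v w p hp => by
      induction p with
      | nil => rfl
      | cons h _ ih => exact h.1.trans (ih hp.of_cons)
  have hf : Function.Bijective f := by
    constructor
    · intro c d
      refine ConnectedComponent.ind₂ (fun v w h => ?_) c d
      have h1 : v.1 = w.1 := h
      rw [ConnectedComponent.eq]
      by_cases h2 : v.2 = w.2
      · rw [Prod.ext h1 h2]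
      · exact Adj.reachable ⟨h1, h2⟩
    · exact fun i => ⟨connectedComponentMk _ (i, ⟨0, ht⟩), rfl⟩
  rw [Nat.card_eq_of_bijective f hf, Nat.card_fin]

theorem IsSumZeroEigenvalue.eq_of_disjointCompleteGraphs {μ : ℝ}
    (h : (disjointCompleteGraphs r t).IsSumZeroEigenvalue μ) : μ = -1 ∨ μ = t - 1 := by
  obtain ⟨x, hx0, -, h⟩ := h
  -- `1 + A` replaces each entry by the sum over its clique.
  have h1 : ∀ i j, (μ + 1) * x (i, j) = ∑ l, x (i, l) := by
    intro i j
    have h2 := congrFun h (i, j)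
    rw [adjMatrix_mulVec_apply, neighborFinset_disjointCompleteGraphs, Finset.sum_product,
      Finset.sum_singleton, Pi.smul_apply, smul_eq_mul] at h2
    rw [← Finset.add_sum_erase _ _ (Finset.mem_univ j), h2]
    ring
  by_contra! hμ
  apply hx0
  have h4 : ∀ i, ∑ l, x (i, l) = 0 := by
    intro i
    have h5 : (μ + 1) * ∑ l, x (i, l) = t * ∑ l, x (i, l) := by
      conv_lhs => rw [Finset.mul_sum]
      simp [h1]
    by_contra h0
    exact hμ.2 (by linarith [mul_right_cancel₀ h0 h5])
  ext ⟨i, j⟩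
  have h6 := h1 i j
  rw [h4, mul_eq_zero] at h6
  exact h6.resolve_left fun h => hμ.1 (by linarith)

theorem euclideanRepNumber_disjointCompleteGraphs (hr : 0 < r) (ht : 2 ≤ t) :
    (disjointCompleteGraphs r t).euclideanRepNumber + r = r * t := by
  have hreg := isRegularOfDegree_disjointCompleteGraphs (r := r) (t := t)
  have hcast : ((t - 1 : ℕ) : ℝ) = t - 1 := by
    rw [Nat.cast_sub (by omega), Nat.cast_one]
  have ht' : (2 : ℝ) ≤ t := by exact_mod_cast ht
  have : Nonempty (Fin r × Fin t) := ⟨(⟨0, hr⟩, ⟨0, by omega⟩)⟩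
  have hmult := sumZeroMultiplicity_natCast_add_one hreg
  rw [natCard_connectedComponent_disjointCompleteGraphs (by omega), hcast] at hmult
  have h := euclideanRepNumber_eq_of_isOuterBound hreg (M := r - 1) ?_
    ⟨t - 1, Or.inr ⟨by linarith, fun μ hμ => ?_⟩, by omega⟩
  · rw [Fintype.card_prod, Fintype.card_fin, Fintype.card_fin] at h
    omega
  · intro θ hθ
    rcases Nat.eq_zero_or_pos ((disjointCompleteGraphs r t).sumZeroMultiplicity θ) with h | h
    · omega
    · rcases (sumZeroMultiplicity_pos_iff.1 h).eq_of_disjointCompleteGraphs with rfl | rfl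
      · rcases hθ with ⟨h, -⟩ | ⟨h, -⟩ <;> linarith
      · omega
  · rcases hμ.eq_of_disjointCompleteGraphs with rfl | rfl <;> linarith

end DisjointCompleteGraphs

/-! ### Case (b). -/

section Regular

variable {V : Type*} [Fintype V] [DecidableEq V] {G : SimpleGraph V}

omit [DecidableEq V] in
theorem euclideanRepNumber_of_iso {r t : ℕ} (hV : 2 ≤ Fintype.card V) (hr : r ≠ Fintype.card V)
    (e : G ≃g disjointCompleteGraphs r t) : G.euclideanRepNumber + r = Fintype.card V := by
  have h := Fintype.card_congr e.toEquiv
  rw [Fintype.card_prod, Fintype.card_fin, Fintype.card_fin] at h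
  have hr0 : r ≠ 0 := by
    rintro rfl
    omega
  have ht0 : t ≠ 0 := by
    rintro rfl
    omega
  have ht1 : t ≠ 1 := by
    rintro rfl
    omega
  rw [euclideanRepNumber_congr e, h]
  exact euclideanRepNumber_disjointCompleteGraphs (by omega) (by omega)

variable [DecidableRel G.Adj] {k : ℕ} (hG : G.IsRegularOfDegree k)
  (hV : 2 ≤ Fintype.card V)
  (hiso : ¬ ∃ r t : ℕ, r ≠ Fintype.card V ∧
    (Nonempty (G ≃g disjointCompleteGraphs r t) ∨ Nonempty (Gᶜ ≃g disjointCompleteGraphs r t)))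
include hG hV hiso

theorem pos_degree_of_not_iso : 0 < k := by
  by_contra hk
  have hk0 : k = 0 := by omega
  subst hk0
  have hGc := hG.compl
  have hna : ∀ u v, ¬ G.Adj u v := fun u v h => by
    have h1 := hG.degree_eq u
    rw [degree_eq_zero] at h1
    exact h1 v h
  -- If `k = 0` the complement is complete, hence excluded.
  obtain ⟨r, ⟨e⟩⟩ := exists_iso_disjointCompleteGraphs hGc fun u v w _ _ huw =>
    (compl_adj G u w).2 ⟨huw, hna u w⟩
  refine hiso ⟨r, _, fun hr => ?_, Or.inr ⟨e⟩⟩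
  have h := Fintype.card_congr e.toEquiv
  rw [Fintype.card_prod, Fintype.card_fin, Fintype.card_fin, hr] at h
  nlinarith [show 2 ≤ Fintype.card V - 1 - 0 + 1 by omega]

theorem exists_isSumZeroEigenvalue_lt_neg_one_of_not_iso :
    ∃ μ, G.IsSumZeroEigenvalue μ ∧ μ < -1 := by
  have : Nonempty V := Fintype.card_pos_iff.1 (by omega)
  refine exists_isSumZeroEigenvalue_lt_neg_one hG (pos_degree_of_not_iso hG hV hiso) ?_
  rintro ⟨r, t, hr, h⟩
  exact hiso ⟨r, t, hr, Or.inl h⟩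

theorem exists_isSumZeroEigenvalue_pos_of_not_iso : ∃ μ, G.IsSumZeroEigenvalue μ ∧ 0 < μ := by
  obtain ⟨μ, h1, h2⟩ := exists_isSumZeroEigenvalue_lt_neg_one_of_not_iso hG.compl hV <| by
    rintro ⟨r, t, hr, h⟩
    rw [compl_compl, or_comm] at h
    exact hiso ⟨r, t, hr, h⟩
  exact ⟨_, h1.of_compl, by linarith⟩

theorem isSumZeroEigenvalue_smallestEigenvalue :
    G.IsSumZeroEigenvalue G.smallestEigenvalue ∧ G.smallestEigenvalue < -1 := by
  have : Nonempty V := Fintype.card_pos_iff.1 (by omega)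
  obtain ⟨μ, h1, h2⟩ := exists_isSumZeroEigenvalue_lt_neg_one_of_not_iso hG hV hiso
  obtain ⟨h3, h4⟩ := G.isLeast_smallestEigenvalue
  have h5 := (h4 h1.mem_adjEigenvalues).trans_lt h2
  refine ⟨isSumZeroEigenvalue_of_ne hG h3 fun h => ?_, h5⟩
  have : (0 : ℝ) ≤ k := k.cast_nonneg
  linarith

/-- If `τ` is the largest eigenvalue with a sum-zero eigenvector, then the representation number
is determined by the multiplicities of the smallest eigenvalue and of `τ`. -/
theorem euclideanRepNumber_add_max {τ : ℝ} (h1 : G.IsSumZeroEigenvalue τ)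
    (h2 : ∀ μ, G.IsSumZeroEigenvalue μ → μ ≤ τ) :
    G.euclideanRepNumber + 1 +
      max (G.adjMultiplicity G.smallestEigenvalue) (G.sumZeroMultiplicity τ) =
        Fintype.card V := by
  have : Nonempty V := Fintype.card_pos_iff.1 (by omega)
  obtain ⟨h3, h4⟩ := isSumZeroEigenvalue_smallestEigenvalue hG hV hiso
  obtain ⟨ν, h5, h6⟩ := exists_isSumZeroEigenvalue_pos_of_not_iso hG hV hiso
  have hmin : ∀ μ, G.IsSumZeroEigenvalue μ → G.smallestEigenvalue ≤ μ := fun μ h =>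
    G.isLeast_smallestEigenvalue.2 h.mem_adjEigenvalues
  have hk : (0 : ℝ) ≤ k := k.cast_nonneg
  rw [adjMultiplicity_eq_of_ne hG (by linarith : G.smallestEigenvalue < k).ne]
  apply euclideanRepNumber_eq_of_isOuterBound hG
  · intro θ hθ
    rcases Nat.eq_zero_or_pos (G.sumZeroMultiplicity θ) with h | h
    · omega
    · have h7 := sumZeroMultiplicity_pos_iff.1 h
      rcases hθ with ⟨-, hθ⟩ | ⟨-, hθ⟩
      · rw [le_antisymm (hθ _ h3) (hmin _ h7)]
        exact le_max_left _ _
      · rw [le_antisymm (h2 _ h7) (hθ _ h1)]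
        exact le_max_right _ _
  · rcases le_total (G.sumZeroMultiplicity G.smallestEigenvalue) (G.sumZeroMultiplicity τ)
      with h | h
    · exact ⟨τ, Or.inr ⟨h6.trans_le (h2 _ h5), h2⟩, (max_eq_right h).le⟩
    · exact ⟨_, Or.inl ⟨h4, hmin⟩, (max_eq_left h).le⟩

/-- Connectedness removes `k` from the sum-zero spectrum, so the second largest eigenvalue becomes
its maximum. -/
theorem euclideanRepNumber_add_max_of_connected (hc : G.Connected) :
    G.euclideanRepNumber + 1 + max (G.adjMultiplicity G.smallestEigenvalue)
      (G.adjMultiplicity G.secondLargestEigenvalue) = Fintype.card V := by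
  have : Nonempty V := Fintype.card_pos_iff.1 (by omega)
  have hcard : Nat.card G.ConnectedComponent = 1 := by
    rw [Nat.card_eq_one_iff_unique]
    exact ⟨hc.preconnected.subsingleton_connectedComponent, inferInstance⟩
  have hmult := sumZeroMultiplicity_natCast_add_one hG
  have hlt : ∀ μ, G.IsSumZeroEigenvalue μ → μ < k := by
    refine fun μ hμ => lt_of_le_of_ne (le_of_mem_adjEigenvalues hG hμ.mem_adjEigenvalues) ?_
    rintro rfl
    have := sumZeroMultiplicity_pos_iff.2 hμ
    omega
  have hkmem := natCast_mem_adjEigenvalues hG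
  obtain ⟨ν, h5, h6⟩ := exists_isSumZeroEigenvalue_pos_of_not_iso hG hV hiso
  obtain ⟨⟨h7, μ, h8, h9⟩, h10⟩ := G.isGreatest_secondLargestEigenvalue
    ⟨ν, h5.mem_adjEigenvalues, k, hkmem, (hlt ν h5).ne⟩
  have hne : G.secondLargestEigenvalue ≠ k :=
    (h9.trans_le (le_of_mem_adjEigenvalues hG h8)).ne
  rw [adjMultiplicity_eq_of_ne hG hne]
  exact euclideanRepNumber_add_max hG hV hiso (isSumZeroEigenvalue_of_ne hG h7 hne)
    fun μ hμ => h10 ⟨hμ.mem_adjEigenvalues, k, hkmem, hlt μ hμ⟩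

/-- Here `k` itself has a sum-zero eigenvector, with sum-zero multiplicity one less than the number
of components. -/
theorem euclideanRepNumber_add_max_of_not_connected (hc : ¬ G.Connected) :
    G.euclideanRepNumber + 1 + max (G.adjMultiplicity G.smallestEigenvalue)
      (Nat.card G.ConnectedComponent - 1) = Fintype.card V := by
  have : Nonempty V := Fintype.card_pos_iff.1 (by omega)
  have hmult := sumZeroMultiplicity_natCast_add_one hG
  have hcard : Nat.card G.ConnectedComponent ≠ 1 := by
    intro h
    rw [Nat.card_eq_one_iff_unique] at h
    have := h.1
    exact hc ⟨fun u v => ConnectedComponent.exact (Subsingleton.elim _ _)⟩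
  rw [← hmult, Nat.add_sub_cancel]
  exact euclideanRepNumber_add_max hG hV hiso (sumZeroMultiplicity_pos_iff.1 (by omega))
    fun μ hμ => le_of_mem_adjEigenvalues hG hμ.mem_adjEigenvalues

end Regular

end SimpleGraph

theorem mainTheorem3 {V : Type*} [Fintype V] [DecidableEq V] (G : SimpleGraph V)
    [DecidableRel G.Adj] (n k : ℕ) (hn : Fintype.card V = n) (hn2 : 2 ≤ n)
    (hG : G.IsRegularOfDegree k) :
    G.IsEuclideanRepresentable G.euclideanRepNumber ∧
    (∀ r t : ℕ, r ≠ n →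
      (Nonempty (G ≃g SimpleGraph.disjointCompleteGraphs r t) ∨
        Nonempty (Gᶜ ≃g SimpleGraph.disjointCompleteGraphs r t)) →
      (G.euclideanRepNumber : ℤ) = n - r) ∧
    ((¬ ∃ r t : ℕ, r ≠ n ∧
      (Nonempty (G ≃g SimpleGraph.disjointCompleteGraphs r t) ∨
        Nonempty (Gᶜ ≃g SimpleGraph.disjointCompleteGraphs r t))) →
      (G.Connected →
        (G.euclideanRepNumber : ℤ) =
          n - 1 - max (G.adjMultiplicity G.smallestEigenvalue : ℤ)
            (G.adjMultiplicity G.secondLargestEigenvalue : ℤ)) ∧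
      (∀ r : ℕ, ¬ G.Connected → Nat.card G.ConnectedComponent = r →
        (G.euclideanRepNumber : ℤ) =
          n - 1 - max (G.adjMultiplicity G.smallestEigenvalue : ℤ) ((r : ℤ) - 1))) := by
  subst hn
  have : Nonempty V := Fintype.card_pos_iff.1 (by omega)
  refine ⟨SimpleGraph.isEuclideanRepresentable_euclideanRepNumber hG, ?_, fun hiso => ⟨?_, ?_⟩⟩
  · rintro r t hr (⟨⟨e⟩⟩ | ⟨⟨e⟩⟩)
    · have := SimpleGraph.euclideanRepNumber_of_iso hn2 hr e
      omega
    · have := SimpleGraph.euclideanRepNumber_of_iso hn2 hr e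
      rw [SimpleGraph.euclideanRepNumber_compl] at this
      omega
  · intro hc
    have := SimpleGraph.euclideanRepNumber_add_max_of_connected hG hn2 hiso hc
    omega
  · intro r hc hr
    have h := SimpleGraph.euclideanRepNumber_add_max_of_not_connected hG hn2 hiso hc
    have hpos : 0 < Nat.card G.ConnectedComponent := Nat.card_pos
    omega
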